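/- All multigraphs here are finite and have no loops (parallel edges are allowed). A cycle in a multigraph is a set consisting of $k\ge 2$ distinct vertices $v_1,\dots,v_k$ and $k$ distinct edges $e_1,\dots,e_k$ such that $e_i$ joins $v_i$ to $v_{i+1}$ for $1\le i<k$ and $e_k$ joins $v_k$ to $v_1$; in particular two parallel edges together with their ends form a cycle. Let $C(G)$ denote the number of cycles of $G$. Theorem. Let $m\ge 3$ and let $G$ be a multigraph with $m$ edges that has the maximum number of cycles among all multigraphs with $m$ edges (and any number of vertices). Then $$\tfrac{9}{10}\cdot 3^{m/3} \;<\; 4\cdot 3^{(m-4)/3} \;\le\; C(G) \;\le\; 8.25\cdot 3^{m/3}.$$ Moreover, the bound $4\cdot 3^{(m-4)/3}$ is already reached by a cycle with multiplied edges: for $n\ge 2$ let $C_{n,m}$ be the multigraph obtained from the cycle of length $n$ by replacing each of $m-\lfloor m/n\rfloor n$ consecutive edges by $\lfloor m/n\rfloor+1$ parallel edges and each of the remaining edges by $\lfloor m/n\rfloor$ parallel edges (the cycle of length $2$ being two vertices joined by two parallel edges). Then, with $n=\max\{2,\lfloor (m+1)/3\rfloor\}$, the multigraph $C_{n,m}$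 has $m$ edges and $C(C_{n,m})\ge 4\cdot 3^{(m-4)/3}$. -/

import Mathlib

namespace Multigraph

variable {α β : Type*}

/-- `(S, T)` is a cycle of the multigraph `G`: for some `k ≥ 2` (written `k + 2` with `k : ℕ`) there
are `k` distinct vertices `v₁, …, vₖ`, whose set is `S`, and `k` distinct edges `e₁, …, eₖ`, whose
set is `T`, such that `eᵢ` joins `vᵢ` to `vᵢ₊₁`, the indices being taken cyclically
(addition in `Fin (k + 2)` is modulo `k + 2`). -/
def IsCycle (G : Graph α β) (C : Set α × Set β) : Prop :=
  ∃ (k : ℕ) (v : Fin (k + 2) → α) (e : Fin (k + 2) → β),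
    Function.Injective v ∧ Function.Injective e ∧
      (∀ i, G.IsLink (e i) (v i) (v (i + 1))) ∧ C = (Set.range v, Set.range e)

/-- The number of cycles of `G` (finite whenever `G` has finitely many vertices and edges). -/
noncomputable def numCycles (G : Graph α β) : ℕ :=
  {C : Set α × Set β | IsCycle G C}.ncard

/-- `G` is a finite multigraph without loops that has exactly `m` edges. -/
structure IsFiniteLooplessWithEdges (G : Graph α β) (m : ℕ) : Prop where
  loopless : G.Loopless
  finite_vertexSet : G.vertexSet.Finite
  finite_edgeSet : G.edgeSet.Finite
  ncard_edgeSet : G.edgeSet.ncard = m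

universe u v

/-- `G` has the maximum number of cycles among all finite loopless multigraphs with `m` edges
(with any number of vertices). -/
structure IsCycleMaximal {α : Type u} {β : Type v} (G : Graph α β) (m : ℕ) : Prop where
  mem : IsFiniteLooplessWithEdges G m
  le : ∀ (α' : Type u) (β' : Type v) (H : Graph α' β'),
    IsFiniteLooplessWithEdges H m → numCycles H ≤ numCycles G

/-- The number of parallel copies of the `i`-th edge of the cycle `Cₙ` when `m` edges are spread
as evenly as possible: `⌊m/n⌋ + 1` for the first `m - ⌊m/n⌋ n` (consecutive) edges and `⌊m/n⌋` for
the rest. -/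
def edgeMultiplicity (n m i : ℕ) : ℕ :=
  if i < m % n then m / n + 1 else m / n

/-- The cycle `Cₙ` with multiplied edges: the vertices are `0, …, n - 1`, and for each `i < n` there
are `edgeMultiplicity n m i` parallel edges `(i, 0), (i, 1), …` between `i` and `i + 1` modulo `n`.
(For `n = 2` all edges are parallel; the graph is used only for `n ≥ 2`.) -/
def multipliedCycle (n m : ℕ) : Graph ℕ (ℕ × ℕ) where
  vertexSet := {x | x < n}
  IsLink e x y :=
    e.1 < n ∧ e.2 < edgeMultiplicity n m e.1 ∧
      ((x = e.1 ∧ y = (e.1 + 1) % n) ∨ (x = (e.1 + 1) % n ∧ y = e.1))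
  isLink_symm := by
    intro e _
    exact ⟨fun x y h => ⟨h.1, h.2.1, h.2.2.symm.imp And.symm And.symm⟩⟩
  eq_or_eq_of_isLink_of_isLink := by
    rintro e x y v w ⟨-, -, h⟩ ⟨-, -, h'⟩
    grind
  left_mem_of_isLink := by
    rintro e x y ⟨h, -, ⟨rfl, -⟩ | ⟨rfl, -⟩⟩
    · exact h
    · exact Nat.mod_lt _ (Nat.zero_lt_of_lt h)

end Multigraph

/-! Write r = 3^(1/3), so that d ≤ r^d for every natural d.

Upper bound: a path from s to t starts with one of the d edges at s and continues among the edges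
avoiding s, so by induction at most r^|E| paths use edges of E (`card_pathsIn_le`). For cycles, fix
a vertex v of degree d on some cycle. Cycles avoiding v are counted by induction; any other is two
edges at v plus a path avoiding v, at most d² r^(|E|-d) in all. The induction closes because d² +
8.25 ≤ 8.25 r^d (`card_cyclesIn_le`).

Lower bound: choosing one copy of each edge of Cₙ gives as many cycles as the product of the
multiplicities, nearly all equal to 3; for m < 8, where n = 2, pairs of parallel edges are counted
instead (`le_numCycles_multipliedCycle`). -/

namespace Multigraph

open Finset

/-! ### Numerical estimates for r = 3^(1/3). -/

section CubeRoot

/-- The real cube root of `3`. -/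
noncomputable def cbrtThree : ℝ := (3 : ℝ) ^ ((1 : ℝ) / 3)

lemma cbrtThree_pos : 0 < cbrtThree := Real.rpow_pos_of_pos (by norm_num) _

lemma cbrtThree_pow_three : cbrtThree ^ 3 = 3 := by
  rw [cbrtThree, ← Real.rpow_natCast, ← Real.rpow_mul (by norm_num)]
  norm_num

lemma three_rpow_div_three (n : ℕ) : (3 : ℝ) ^ ((n : ℝ) / 3) = cbrtThree ^ n := by
  rw [cbrtThree, ← Real.rpow_natCast, ← Real.rpow_mul (by norm_num)]
  congr 1
  ring

/-- Taking out 3² makes the exponent of r natural even for m = 3. -/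
lemma three_rpow_sub_four_div_three (m : ℕ) :
    4 * (3 : ℝ) ^ (((m : ℝ) - 4) / 3) = 4 / 9 * cbrtThree ^ (m + 2) := by
  rw [← three_rpow_div_three, show (((m : ℝ) - 4) / 3) = ((m + 2 : ℕ) : ℝ) / 3 - (2 : ℕ) by
    push_cast; ring, Real.rpow_sub_natCast (by norm_num)]
  ring

lemma lt_cbrtThree : 1.44 < cbrtThree := by
  refine lt_of_pow_lt_pow_left₀ 3 cbrtThree_pos.le ?_
  rw [cbrtThree_pow_three]
  norm_num

lemma cbrtThree_lt : cbrtThree < 1.443 := by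
  refine lt_of_pow_lt_pow_left₀ 3 (by norm_num) ?_
  rw [cbrtThree_pow_three]
  norm_num

lemma nat_pow_three_le_three_pow (d : ℕ) : d ^ 3 ≤ 3 ^ d := by
  by_cases h : d < 3
  · interval_cases d <;> norm_num
  · push Not at h
    induction d, h using Nat.le_induction with
    | base => norm_num
    | succ d hd ih =>
      have : (d + 1) ^ 3 ≤ 3 * d ^ 3 := by nlinarith [mul_le_mul hd hd (by lia) (by lia)]
      rw [pow_succ 3]
      lia

lemma nat_le_cbrtThree_pow (d : ℕ) : (d : ℝ) ≤ cbrtThree ^ d := by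
  refine le_of_pow_le_pow_left₀ (n := 3) (by norm_num) (pow_nonneg cbrtThree_pos.le _) ?_
  rw [← pow_mul, mul_comm, pow_mul, cbrtThree_pow_three]
  exact_mod_cast nat_pow_three_le_three_pow d

lemma sq_add_le_cbrtThree_pow {d : ℕ} (hd : 1 ≤ d) :
    (d : ℝ) ^ 2 + 8.25 ≤ 8.25 * cbrtThree ^ d := by
  have hr := lt_cbrtThree
  induction d, hd using Nat.le_induction with
  | base => norm_num at hr ⊢; linarith
  | succ d hd ih =>
    rw [pow_succ cbrtThree, ← mul_assoc]
    have h1 := mul_le_mul ih hr.le (by norm_num) (by positivity [cbrtThree_pos])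
    refine le_trans ?_ h1
    push_cast
    -- What remains is 0.44d² - 2d + 2.63 ≥ 0, whose discriminant is negative.
    nlinarith [sq_nonneg ((d : ℝ) - 2)]

end CubeRoot

/-! ### Counting paths and cycles by edge sets. -/

section UpperBound

variable {α β : Type*} {G : Graph α β}

open Classical in
/-- `IsPathIn G E s t T`: the set `T` consists of the edges of a path of `G` from `s` to `t`
all of whose edges lie in `E`. -/
inductive IsPathIn (G : Graph α β) : Finset β → α → α → Finset β → Prop
  | nil (E : Finset β) (s : α) : IsPathIn G E s s ∅
  | cons {E E' : Finset β} {s x t : α} {e : β} {T : Finset β} (he : e ∈ E)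
      (hl : G.IsLink e s x) (hst : s ≠ t) (hE' : ∀ f, f ∈ E' ↔ f ∈ E ∧ ¬ G.Inc f s)
      (hT : IsPathIn G E' x t T) : IsPathIn G E s t (insert e T)

open Classical in
/-- The edge sets of the paths from `s` to `t` with edges in `E`. -/
noncomputable def pathsIn (G : Graph α β) (E : Finset β) (s t : α) : Finset (Finset β) :=
  E.powerset.filter (IsPathIn G E s t)

open Classical in
/-- The edge sets of the cycles with edges in `E`. -/
noncomputable def cyclesIn (G : Graph α β) (E : Finset β) : Finset (Finset β) :=
  E.powerset.filter fun T => ∃ S, IsCycle G (S, (T : Set β))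

open Classical in
/-- The edges of `E` incident with `v`. -/
noncomputable def incIn (G : Graph α β) (E : Finset β) (v : α) : Finset β :=
  E.filter fun e => ∃ x, G.IsLink e v x

open Classical in
/-- The end of `e` other than `v`. -/
noncomputable def otherEnd (G : Graph α β) (e : β) (v : α) : α :=
  if h : G.Inc e v then h.other else v

lemma otherEnd_eq {e : β} {v x : α} (h : G.IsLink e v x) : otherEnd G e v = x := by
  rw [otherEnd, dif_pos h.inc_left]
  exact h.inc_left.isLink_other.right_unique h

open Classical in
lemma IsPathIn.subset {E T : Finset β} {s t : α} (h : IsPathIn G E s t T) :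
    T ⊆ E := by
  induction h with
  | nil => simp
  | cons he hl hst hE' _ ih =>
    rw [insert_subset_iff]
    exact ⟨he, fun f hf => ((hE' f).1 (ih hf)).1⟩

open Classical in
lemma card_incIn_add (E : Finset β) (v : α) :
    #(E \ incIn G E v) + #(incIn G E v) = #E :=
  card_sdiff_add_card_eq_card (filter_subset _ _)

open Classical in
lemma mem_sdiff_incIn {E : Finset β} {v : α} {f : β} :
    f ∈ E \ incIn G E v ↔ f ∈ E ∧ ¬ G.Inc f v := by
  simp only [incIn, mem_sdiff, mem_filter]
  tauto

lemma card_pathsIn_le (E : Finset β) (s t : α) : (#(pathsIn G E s t) : ℝ) ≤ cbrtThree ^ #E := by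
  classical
  induction hn : #E using Nat.strong_induction_on generalizing E s with
  | _ n ih =>
  subst hn
  by_cases hst : s = t
  · have : pathsIn G E s t ⊆ {∅} := by
      intro T hT
      simp only [pathsIn, mem_filter] at hT
      cases hT.2 with
      | nil => simp
      | cons _ _ h => exact absurd hst h
    have h1 : (#(pathsIn G E s t) : ℝ) ≤ 1 := by exact_mod_cast card_le_card this
    exact h1.trans (one_le_pow₀ (by linarith [lt_cbrtThree]))
  · set D := incIn G E s with hD
    have hsub : pathsIn G E s t ⊆
        D.biUnion fun e => (pathsIn G (E \ D) (otherEnd G e s) t).image (insert e) := by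
      intro T hT
      simp only [pathsIn, mem_filter] at hT
      cases hT.2 with
      | nil => exact absurd rfl hst
      | @cons _ E' _ x _ e T he hl _ hE' hT' =>
        have hE : E' = E \ D := by
          ext f
          rw [hE', hD, mem_sdiff_incIn]
        subst hE
        rw [mem_biUnion]
        refine ⟨e, mem_filter.2 ⟨he, hl.inc_left⟩, mem_image_of_mem _ ?_⟩
        rw [otherEnd_eq hl]
        exact mem_filter.2 ⟨mem_powerset.2 hT'.subset, hT'⟩
    have hcard := card_incIn_add (G := G) E s
    rw [← hD] at hcard
    rcases D.eq_empty_or_nonempty with h0 | h0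
    · rw [h0, biUnion_empty, subset_empty] at hsub
      rw [hsub]
      simpa using (pow_pos cbrtThree_pos _).le
    · have hpos := h0.card_pos
      calc (#(pathsIn G E s t) : ℝ)
          ≤ ∑ e ∈ D, (#(pathsIn G (E \ D) (otherEnd G e s) t) : ℝ) := by
            exact_mod_cast (card_le_card hsub).trans
              (card_biUnion_le.trans (sum_le_sum fun e _ => card_image_le))
        _ ≤ ∑ e ∈ D, cbrtThree ^ #(E \ D) :=
            sum_le_sum fun e _ => ih _ (by lia) _ _ rfl
        _ = #D * cbrtThree ^ #(E \ D) := by rw [sum_const, nsmul_eq_mul]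
        _ ≤ cbrtThree ^ #D * cbrtThree ^ #(E \ D) := by
            gcongr
            · exact (pow_pos cbrtThree_pos _).le
            · exact nat_le_cbrtThree_pow _
        _ = cbrtThree ^ #E := by rw [← pow_add, ← hcard, add_comm]

open Classical in
-- `IsPathIn` prevents revisits by deleting all edges at each vertex left; injectivity of `w`
-- ensures that later edges survive these deletions.
lemma isPathIn_of_injOn (w : ℕ → α) (f : ℕ → β) (b n : ℕ) :
    ∀ (a : ℕ) (E : Finset β), a + n = b →
      Set.InjOn w (Set.Icc a b) → (∀ i ∈ Set.Ico a b, G.IsLink (f i) (w i) (w (i + 1))) →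
      (∀ i ∈ Set.Ico a b, f i ∈ E) → IsPathIn G E (w a) (w b) ((Finset.Ico a b).image f) := by
  induction n with
  | zero =>
    rintro a E rfl - - -
    simpa using IsPathIn.nil E (w a)
  | succ n ih =>
    intro a E hab hw hl hE
    rw [← insert_Ico_add_one_left_eq_Ico (by lia), image_insert]
    refine .cons (E' := E \ incIn G E (w a)) (hE a ⟨le_rfl, by lia⟩) (hl a ⟨le_rfl, by lia⟩)
      (fun h => ?_) (fun _ => mem_sdiff_incIn) (ih (a + 1) _ (by lia) ?_ ?_ ?_)
    · have := hw ⟨le_rfl, by lia⟩ ⟨by lia, le_rfl⟩ h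
      lia
    · exact hw.mono (Set.Icc_subset_Icc_left (by lia))
    · exact fun i hi => hl i ⟨by have := hi.1; lia, hi.2⟩
    · rintro i ⟨hi1, hi2⟩
      rw [mem_sdiff_incIn]
      refine ⟨hE i ⟨by lia, hi2⟩, fun h => ?_⟩
      rcases h.eq_or_eq_of_isLink (hl i ⟨by lia, hi2⟩) with h | h
      · have := hw ⟨le_rfl, by lia⟩ ⟨by lia, by lia⟩ h
        lia
      · have := hw ⟨le_rfl, by lia⟩ ⟨by lia, by lia⟩ h
        lia

open scoped Fin.CommRing in
open Classical in
lemma exists_path_of_cycle {E T : Finset β} {S : Set α} {v : α}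
    (hT : IsCycle G (S, (T : Set β))) (hTE : T ⊆ E) {e₀ : β} (he₀ : e₀ ∈ T) (hv : G.Inc e₀ v) :
    ∃ e ∈ incIn G E v, ∃ e' ∈ incIn G E v,
      ∃ P ∈ pathsIn G (E \ incIn G E v) (otherEnd G e v) (otherEnd G e' v),
        T = insert e (insert e' P) := by
  classical
  obtain ⟨k, x, f, hx, hf, hl, h⟩ := hT
  rw [Prod.mk.injEq] at h
  obtain ⟨-, hTf⟩ := h
  have hmem (i) : f i ∈ E := hTE (by rw [← mem_coe, hTf]; exact ⟨i, rfl⟩)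
  obtain ⟨j, rfl⟩ : ∃ j, x j = v := by
    rw [← mem_coe, hTf] at he₀
    obtain ⟨i, rfl⟩ := he₀
    rcases hv.eq_or_eq_of_isLink (hl i) with h | h
    · exact ⟨_, h.symm⟩
    · exact ⟨_, h.symm⟩
  set w : ℕ → α := fun n => x (j + (n : Fin (k + 2))) with hw
  set g : ℕ → β := fun n => f (j + (n : Fin (k + 2))) with hg
  have hlink (n : ℕ) : G.IsLink (g n) (w n) (w (n + 1)) := by
    have := hl (j + (n : Fin (k + 2)))
    rwa [add_assoc, ← Nat.cast_add_one] at this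
  have hcast {a b : ℕ} (ha : a < k + 2) (hb : b < k + 2)
      (h : (a : Fin (k + 2)) = (b : Fin (k + 2))) : a = b := by
    have := congrArg Fin.val h
    rwa [Fin.val_natCast, Fin.val_natCast, Nat.mod_eq_of_lt ha, Nat.mod_eq_of_lt hb] at this
  have hinj {a b : ℕ} (ha : a < k + 2) (hb : b < k + 2) (h : w a = w b) : a = b :=
    hcast ha hb (add_left_cancel (hx h))
  have h0 : w 0 = x j := by simp [hw]
  have hk : w (k + 2) = x j := by simp [hw]
  have hTg : T = (range (k + 2)).image g := by
    rw [← coe_inj, hTf]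
    ext y
    simp only [Set.mem_range, coe_image, Set.mem_image, coe_range, Set.mem_Iio]
    constructor
    · rintro ⟨i, rfl⟩
      exact ⟨(i - j).val, (i - j).isLt, by simp [hg]⟩
    · rintro ⟨i, -, rfl⟩
      exact ⟨_, rfl⟩
  have hfirst : G.IsLink (g 0) (x j) (w 1) := h0 ▸ hlink 0
  have hlast : G.IsLink (g (k + 1)) (x j) (w (k + 1)) := hk ▸ (hlink (k + 1)).symm
  -- With the indices rotated to start at v, the first and last edges meet v and the rest is a path
  -- avoiding v, empty when k = 0.
  refine ⟨g 0, mem_filter.2 ⟨hmem _, hfirst.inc_left⟩,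
    g (k + 1), mem_filter.2 ⟨hmem _, hlast.inc_left⟩, (Ico 1 (k + 1)).image g, ?_, ?_⟩
  · rw [otherEnd_eq hfirst, otherEnd_eq hlast]
    have := isPathIn_of_injOn (G := G) w g (k + 1) k 1 (E \ incIn G E (x j)) (by lia)
      (fun a ha b hb h => hinj (by have := ha.2; lia) (by have := hb.2; lia) h) (fun i _ => hlink i) ?_
    · exact mem_filter.2 ⟨mem_powerset.2 this.subset, this⟩
    · rintro i ⟨hi1, hi2⟩
      rw [mem_sdiff_incIn]
      refine ⟨hmem _, fun h => ?_⟩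
      rcases h.eq_or_eq_of_isLink (hlink i) with h | h
      · have := hinj (by lia) (by lia) (h0.trans h)
        lia
      · have := hinj (by lia) (by lia) (h0.trans h)
        lia
  · rw [hTg, ← image_insert, ← image_insert]
    congr 1
    ext i
    simp only [mem_range, mem_insert, mem_Ico]
    lia

lemma card_cyclesIn_le (E : Finset β) : (#(cyclesIn G E) : ℝ) ≤ 8.25 * cbrtThree ^ #E := by
  classical
  induction hn : #E using Nat.strong_induction_on generalizing E with
  | _ n ih =>
  subst hn
  have hr := cbrtThree_pos
  rcases (cyclesIn G E).eq_empty_or_nonempty with h0 | ⟨T₀, hT₀⟩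
  · rw [h0]
    simp only [card_empty, Nat.cast_zero]
    positivity
  obtain ⟨hT₀E, S₀, k, x, f, hx, hf, hl, h⟩ := mem_filter.1 hT₀
  rw [mem_powerset] at hT₀E
  rw [Prod.mk.injEq] at h
  have hf0 : f 0 ∈ E := hT₀E (by rw [← mem_coe, h.2]; exact ⟨0, rfl⟩)
  set v := x 0
  set D := incIn G E v with hD
  have hDpos : 0 < #D := card_pos.2 ⟨f 0, mem_filter.2 ⟨hf0, (hl 0).inc_left⟩⟩
  have hcard := card_incIn_add (G := G) E v
  rw [← hD] at hcard
  -- Ordered pairs overcount, but the constant 8.25 absorbs this.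
  have hsub : cyclesIn G E ⊆ cyclesIn G (E \ D) ∪ (D ×ˢ D).biUnion fun p =>
      (pathsIn G (E \ D) (otherEnd G p.1 v) (otherEnd G p.2 v)).image
        fun P => insert p.1 (insert p.2 P) := by
    intro T hT
    obtain ⟨hTE, S, hS⟩ := mem_filter.1 hT
    rw [mem_powerset] at hTE
    by_cases hav : ∃ e₀ ∈ T, G.Inc e₀ v
    · obtain ⟨e₀, he₀, hv⟩ := hav
      obtain ⟨e, he, e', he', P, hP, rfl⟩ := exists_path_of_cycle hS hTE he₀ hv
      exact mem_union_right _ (mem_biUnion.2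
        ⟨(e, e'), mem_product.2 ⟨he, he'⟩, mem_image.2 ⟨P, hP, rfl⟩⟩)
    · push Not at hav
      exact mem_union_left _ (mem_filter.2
        ⟨mem_powerset.2 fun e he => mem_sdiff_incIn.2 ⟨hTE he, hav e he⟩, S, hS⟩)
  calc (#(cyclesIn G E) : ℝ)
      ≤ #(cyclesIn G (E \ D)) + ∑ p ∈ D ×ˢ D,
          (#(pathsIn G (E \ D) (otherEnd G p.1 v) (otherEnd G p.2 v)) : ℝ) := by
        exact_mod_cast (card_le_card hsub).trans ((card_union_le _ _).trans
          (Nat.add_le_add_left (card_biUnion_le.trans (sum_le_sum fun e _ => card_image_le)) _))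
    _ ≤ 8.25 * cbrtThree ^ #(E \ D) + ∑ p ∈ D ×ˢ D, cbrtThree ^ #(E \ D) :=
        add_le_add (ih _ (by lia) _ rfl) (sum_le_sum fun p _ => card_pathsIn_le _ _ _)
    _ = ((#D : ℝ) ^ 2 + 8.25) * cbrtThree ^ #(E \ D) := by
        rw [sum_const, nsmul_eq_mul, card_product]
        push_cast
        ring
    _ ≤ 8.25 * cbrtThree ^ #D * cbrtThree ^ #(E \ D) := by
        gcongr
        exact sq_add_le_cbrtThree_pow hDpos
    _ = 8.25 * cbrtThree ^ #E := by rw [mul_assoc, ← pow_add, ← hcard, add_comm]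

/-- Makes a cycle recoverable from its edge set, so counting edge sets suffices. -/
lemma IsCycle.vertexSet_eq {S : Set α} {T : Set β} (h : IsCycle G (S, T)) :
    S = {x | ∃ e ∈ T, G.Inc e x} := by
  obtain ⟨k, v, e, -, -, hl, h⟩ := h
  obtain ⟨rfl, rfl⟩ := Prod.mk.inj h
  ext x
  constructor
  · rintro ⟨i, rfl⟩
    exact ⟨e i, ⟨i, rfl⟩, (hl i).inc_left⟩
  · rintro ⟨_, ⟨i, rfl⟩, hx⟩
    rcases hx.eq_or_eq_of_isLink (hl i) with h | h
    · exact ⟨_, h.symm⟩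
    · exact ⟨_, h.symm⟩

lemma IsCycle.edgeSet_subset {C : Set α × Set β} (h : IsCycle G C) : C.2 ⊆ G.edgeSet := by
  obtain ⟨k, v, e, -, -, hl, rfl⟩ := h
  rintro _ ⟨i, rfl⟩
  exact (hl i).edge_mem

lemma IsCycle.vertexSet_subset {C : Set α × Set β} (h : IsCycle G C) : C.1 ⊆ G.vertexSet := by
  obtain ⟨k, v, e, -, -, hl, rfl⟩ := h
  rintro _ ⟨i, rfl⟩
  exact (hl i).left_mem

lemma IsFiniteLooplessWithEdges.finite_cycles {m : ℕ} (hG : IsFiniteLooplessWithEdges G m) :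
    {C : Set α × Set β | IsCycle G C}.Finite :=
  (hG.finite_vertexSet.powerset.prod hG.finite_edgeSet.powerset).subset
    fun _ hC => ⟨hC.vertexSet_subset, hC.edgeSet_subset⟩

lemma IsFiniteLooplessWithEdges.numCycles_le {m : ℕ} (hG : IsFiniteLooplessWithEdges G m) :
    (numCycles G : ℝ) ≤ 8.25 * cbrtThree ^ m := by
  classical
  obtain ⟨-, -, hE, hm⟩ := hG
  have hm' : #hE.toFinset = m := by rw [← hm, Set.ncard_eq_toFinset_card _ hE]
  refine le_trans ?_ (hm' ▸ card_cyclesIn_le (G := G) hE.toFinset)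
  rw [← Set.ncard_coe_finset]
  have hfin (C : Set α × Set β) (hC : IsCycle G C) : C.2.Finite := hE.subset hC.edgeSet_subset
  refine Nat.cast_le.2 (Set.ncard_le_ncard_of_injOn
    (fun C => if h : C.2.Finite then h.toFinset else ∅) ?_ ?_ (finite_toSet _))
  · intro C hC
    simp only [dif_pos (hfin C hC)]
    refine mem_coe.2 (mem_filter.2 ⟨mem_powerset.2 ?_, C.1, ?_⟩)
    · exact fun e he => hE.mem_toFinset.2 (hC.edgeSet_subset (by simpa using he))
    · simpa using hC
  · rintro ⟨S, T⟩ hC ⟨S', T'⟩ hC' h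
    simp only [dif_pos (hfin _ hC), dif_pos (hfin _ hC')] at h
    obtain rfl : T = T' := by simpa using h
    rw [IsCycle.vertexSet_eq hC, IsCycle.vertexSet_eq hC']

end UpperBound

/-! ### Cycles in the multiplied cycle. -/

section MultipliedCycle

lemma sum_edgeMultiplicity {n m : ℕ} (hn : 0 < n) :
    ∑ i ∈ range n, edgeMultiplicity n m i = m := by
  have hlt := Nat.mod_lt m hn
  have h1 (i : ℕ) : edgeMultiplicity n m i = m / n + if i < m % n then 1 else 0 := by
    rw [edgeMultiplicity]
    split_ifs <;> rfl
  have h2 : (range n).filter (· < m % n) = range (m % n) := by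
    ext i
    simp only [mem_filter, mem_range]
    lia
  rw [sum_congr rfl fun i _ => h1 i, sum_add_distrib, sum_const, card_range, smul_eq_mul,
    sum_boole, h2, card_range, Nat.cast_id]
  exact Nat.div_add_mod m n

lemma prod_edgeMultiplicity {n m : ℕ} (hn : 0 < n) :
    ∏ i ∈ range n, edgeMultiplicity n m i = (m / n + 1) ^ (m % n) * (m / n) ^ (n - m % n) := by
  have hlt := Nat.mod_lt m hn
  rw [← prod_range_mul_prod_Ico _ hlt.le]
  congr 1
  · rw [prod_congr rfl (g := fun _ => m / n + 1), prod_const, card_range]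
    intro i hi
    exact if_pos (mem_range.1 hi)
  · rw [prod_congr rfl (g := fun _ => m / n), prod_const, Nat.card_Ico]
    intro i hi
    exact if_neg (not_lt.2 (mem_Ico.1 hi).1)

/-- The edges of the multiplied cycle, as a finset. -/
def multipliedCycleEdges (n m : ℕ) : Finset (ℕ × ℕ) :=
  ((range n).sigma fun i => range (edgeMultiplicity n m i)).map
    (Equiv.sigmaEquivProd ℕ ℕ).toEmbedding

lemma mem_multipliedCycleEdges {n m : ℕ} {e : ℕ × ℕ} :
    e ∈ multipliedCycleEdges n m ↔ e.1 < n ∧ e.2 < edgeMultiplicity n m e.1 := by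
  simp [multipliedCycleEdges, mem_map_equiv]

lemma card_multipliedCycleEdges {n m : ℕ} (hn : 0 < n) : #(multipliedCycleEdges n m) = m := by
  rw [multipliedCycleEdges, card_map, card_sigma]
  simp [sum_edgeMultiplicity hn]

lemma edgeSet_multipliedCycle (n m : ℕ) :
    (multipliedCycle n m).edgeSet = multipliedCycleEdges n m := by
  ext e
  rw [mem_coe, mem_multipliedCycleEdges, Graph.edge_mem_iff_exists_isLink]
  constructor
  · rintro ⟨x, y, h1, h2, -⟩
    exact ⟨h1, h2⟩
  · rintro ⟨h1, h2⟩
    exact ⟨_, _, h1, h2, .inl ⟨rfl, rfl⟩⟩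

lemma isFiniteLooplessWithEdges_multipliedCycle {n : ℕ} (hn : 2 ≤ n) (m : ℕ) :
    IsFiniteLooplessWithEdges (multipliedCycle n m) m where
  loopless := by
    refine ⟨fun e x h => ?_⟩
    obtain ⟨h1, -, h⟩ := h
    have h3 : e.1 = (e.1 + 1) % n := by grind
    rcases Nat.lt_or_ge (e.1 + 1) n with h4 | h4
    · rw [Nat.mod_eq_of_lt h4] at h3
      lia
    · rw [show e.1 + 1 = n by lia, Nat.mod_self] at h3
      lia
  finite_vertexSet := Set.finite_lt_nat n
  finite_edgeSet := by
    rw [edgeSet_multipliedCycle]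
    exact finite_toSet _
  ncard_edgeSet := by
    rw [edgeSet_multipliedCycle, Set.ncard_coe_finset, card_multipliedCycleEdges (by lia)]

lemma prod_edgeMultiplicity_le_numCycles (k m : ℕ) :
    ∏ i ∈ range (k + 2), edgeMultiplicity (k + 2) m i ≤
      numCycles (multipliedCycle (k + 2) m) := by
  rw [prod_range, ← prod_congr rfl fun i _ => card_range _, ← Fintype.card_piFinset,
    ← Set.ncard_coe_finset]
  refine Set.ncard_le_ncard_of_injOn
    (fun c => (Set.range fun i : Fin (k + 2) => (i : ℕ),
      Set.range fun i : Fin (k + 2) => ((i : ℕ), c i))) ?_ ?_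
    (isFiniteLooplessWithEdges_multipliedCycle (by lia) m).finite_cycles
  · intro c hc
    rw [mem_coe, Fintype.mem_piFinset] at hc
    refine ⟨k, _, _, Fin.val_injective, ?_, ?_, rfl⟩
    · exact fun i j h => Fin.ext (Prod.mk.inj h).1
    · exact fun i => ⟨i.isLt, mem_range.1 (hc i), .inl ⟨rfl, by simp [Fin.val_add]⟩⟩
  · intro c _ c' _ h
    funext i
    have h2 : ((i : ℕ), c i) ∈ Set.range fun i : Fin (k + 2) => ((i : ℕ), c' i) := by
      rw [← (Prod.mk.inj h).2]
      exact ⟨i, rfl⟩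
    obtain ⟨j, hj⟩ := h2
    obtain ⟨h3, h4⟩ := Prod.mk.inj hj
    rw [← h4, Fin.ext h3]

/-- For m = 3 the product of multiplicities is only 2, below the bound; using all pairs repairs
this. -/
lemma choose_two_le_numCycles (m : ℕ) : m.choose 2 ≤ numCycles (multipliedCycle 2 m) := by
  have hl (e : ℕ × ℕ) (he : e ∈ multipliedCycleEdges 2 m) :
      (multipliedCycle 2 m).IsLink e 0 1 ∧ (multipliedCycle 2 m).IsLink e 1 0 := by
    obtain ⟨h1, h2⟩ := mem_multipliedCycleEdges.1 he
    have h3 : e.1 = 0 ∨ e.1 = 1 := by lia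
    refine ⟨⟨h1, h2, ?_⟩, ⟨h1, h2, ?_⟩⟩ <;> rcases h3 with h3 | h3 <;> simp [h3]
  rw [← card_multipliedCycleEdges (m := m) two_pos, ← card_powersetCard,
    card_multipliedCycleEdges two_pos, ← Set.ncard_coe_finset]
  refine Set.ncard_le_ncard_of_injOn (fun T => (Set.range ![0, 1], (T : Set (ℕ × ℕ)))) ?_ ?_
    (isFiniteLooplessWithEdges_multipliedCycle le_rfl m).finite_cycles
  · intro T hT
    obtain ⟨hT, hc⟩ := mem_powersetCard.1 (mem_coe.1 hT)
    obtain ⟨a, b, hab, rfl⟩ := card_eq_two.1 hc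
    refine ⟨0, ![0, 1], ![a, b], ?_, ?_, ?_, ?_⟩
    · intro i j
      fin_cases i <;> fin_cases j <;> simp
    · intro i j
      fin_cases i <;> fin_cases j <;> simp [hab, hab.symm]
    · intro i
      fin_cases i
      · exact (hl a (hT (by simp))).1
      · exact (hl b (hT (by simp))).2
    · simp [Set.pair_comm]
  · intro T _ T' _ h
    exact coe_injective (Prod.mk.inj h).2

lemma le_numCycles_multipliedCycle {m : ℕ} (hm : 3 ≤ m) :
    4 / 9 * cbrtThree ^ (m + 2) ≤ (numCycles (multipliedCycle (max 2 ((m + 1) / 3)) m) : ℝ) := by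
  have hr := cbrtThree_pos
  have hr3 := cbrtThree_pow_three
  have hlt := cbrtThree_lt
  have hsq : cbrtThree ^ 2 < 2.0823 := by norm_num at hlt ⊢; nlinarith
  rcases Nat.lt_or_ge m 8 with h8 | h8
  · rw [max_eq_left (by lia)]
    refine le_trans ?_ (Nat.cast_le.2 (choose_two_le_numCycles m))
    have h4 : cbrtThree ^ 4 = 3 * cbrtThree := by linear_combination cbrtThree * hr3
    have h5 : cbrtThree ^ 5 = 3 * cbrtThree ^ 2 := by linear_combination cbrtThree ^ 2 * hr3
    have h6 : cbrtThree ^ 6 = 9 := by linear_combination (cbrtThree ^ 3 + 3) * hr3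
    have h7 : cbrtThree ^ 7 = 9 * cbrtThree := by linear_combination cbrtThree * h6
    have h9 : cbrtThree ^ 8 = 9 * cbrtThree ^ 2 := by linear_combination cbrtThree ^ 2 * h6
    have h10 : cbrtThree ^ 9 = 27 := by linear_combination cbrtThree ^ 3 * h6 + 9 * hr3
    norm_num at hlt hsq
    interval_cases m <;> norm_num [h5, h6, h7, h9, h10, Nat.choose] <;> linarith
  · rw [max_eq_right (by lia)]
    obtain ⟨k, hk⟩ : ∃ k, (m + 1) / 3 = k + 2 := ⟨(m + 1) / 3 - 2, by lia⟩
    rw [hk]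
    refine le_trans ?_ (Nat.cast_le.2 (prod_edgeMultiplicity_le_numCycles k m))
    rw [prod_edgeMultiplicity (by lia)]
    have hpow (j : ℕ) : cbrtThree ^ (3 * j) = 3 ^ j := by rw [pow_mul, hr3]
    have h3 : (0 : ℝ) < 3 ^ k := by positivity
    -- The multiplicities are all 3 except, respectively, one 2, none, one 4; the last case attains
    -- the bound exactly.
    have hcases : m = 3 * k + 5 ∨ m = 3 * k + 6 ∨ m = 3 * k + 7 := by lia
    rcases hcases with rfl | rfl | rfl
    · have hd : (3 * k + 5) / (k + 2) = 2 := by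
        rw [Nat.div_eq_iff (by lia)]; lia
      have hmod : (3 * k + 5) % (k + 2) = k + 1 := by
        have := Nat.div_add_mod (3 * k + 5) (k + 2)
        rw [hd] at this
        lia
      rw [hd, hmod, show k + 2 - (k + 1) = 1 by lia,
        show 3 * k + 5 + 2 = 3 * (k + 2) + 1 by lia, pow_succ, hpow]
      push_cast
      rw [pow_add]
      norm_num [pow_succ (3 : ℝ) k] at hlt ⊢
      nlinarith
    · have hd : (3 * k + 6) / (k + 2) = 3 := by
        rw [Nat.div_eq_iff (by lia)]; lia
      have hmod : (3 * k + 6) % (k + 2) = 0 := by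
        have := Nat.div_add_mod (3 * k + 6) (k + 2)
        rw [hd] at this
        lia
      rw [hd, hmod, Nat.sub_zero, show 3 * k + 6 + 2 = 3 * (k + 2) + 2 by lia, pow_add, hpow]
      push_cast
      rw [pow_add]
      norm_num at hsq ⊢
      nlinarith
    · have hk1 : 1 ≤ k := by lia
      have hd : (3 * k + 7) / (k + 2) = 3 := by
        rw [Nat.div_eq_iff (by lia)]; lia
      have hmod : (3 * k + 7) % (k + 2) = 1 := by
        have := Nat.div_add_mod (3 * k + 7) (k + 2)
        rw [hd] at this
        lia
      rw [hd, hmod, show k + 2 - 1 = k + 1 by lia,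
        show 3 * k + 7 + 2 = 3 * (k + 3) by lia, hpow]
      push_cast
      rw [pow_add, pow_succ (3 : ℝ) k]
      norm_num
      linarith

end MultipliedCycle

/-! ### Moving multigraphs between types. -/

section Transport

variable {α β α' β' : Type*}

/-- The copy of a multigraph along bijections of the vertex and edge types. -/
def copyAlong (G : Graph α β) (f : α' ≃ α) (g : β' ≃ β) : Graph α' β' where
  vertexSet := f ⁻¹' G.vertexSet
  edgeSet := g ⁻¹' G.edgeSet
  IsLink e x y := G.IsLink (g e) (f x) (f y)
  isLink_symm := fun _ _ => ⟨fun _ _ h => Graph.IsLink.symm h⟩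
  eq_or_eq_of_isLink_of_isLink := fun _ _ _ _ _ h h' =>
    (h.left_eq_or_eq h').imp (fun h => f.injective h) (fun h => f.injective h)
  edge_mem_iff_exists_isLink := by
    intro e
    rw [Set.mem_preimage, Graph.edge_mem_iff_exists_isLink, f.surjective.exists]
    exact exists_congr fun x => f.surjective.exists
  left_mem_of_isLink := fun _ _ _ h => h.left_mem

lemma IsFiniteLooplessWithEdges.copyAlong {G : Graph α β} {m : ℕ}
    (hG : IsFiniteLooplessWithEdges G m) (f : α' ≃ α) (g : β' ≃ β) :
    IsFiniteLooplessWithEdges (copyAlong G f g) m where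
  loopless := ⟨fun e x h => hG.loopless.not_isLoopAt (g e) (f x) h⟩
  finite_vertexSet := hG.finite_vertexSet.preimage f.injective.injOn
  finite_edgeSet := hG.finite_edgeSet.preimage g.injective.injOn
  ncard_edgeSet := by
    rw [← hG.ncard_edgeSet]
    exact Set.ncard_preimage_of_injective_subset_range g.injective (by simp)

lemma IsFiniteLooplessWithEdges.numCycles_le_copyAlong {G : Graph α β} {m : ℕ}
    (hG : IsFiniteLooplessWithEdges G m) (f : α' ≃ α) (g : β' ≃ β) :
    numCycles G ≤ numCycles (Multigraph.copyAlong G f g) := by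
  refine Set.ncard_le_ncard_of_injOn (fun C => (f.symm '' C.1, g.symm '' C.2)) ?_ ?_
    (hG.copyAlong f g).finite_cycles
  · rintro _ ⟨k, v, e, hv, he, hl, rfl⟩
    refine ⟨k, f.symm ∘ v, g.symm ∘ e, f.symm.injective.comp hv, g.symm.injective.comp he, ?_, ?_⟩
    · intro i
      simpa [Multigraph.copyAlong] using hl i
    · simp only [Set.range_comp]
  · rintro ⟨S, T⟩ _ ⟨S', T'⟩ _ h
    obtain ⟨h1, h2⟩ := Prod.mk.inj h
    exact Prod.ext (f.symm.injective.image_injective h1) (g.symm.injective.image_injective h2)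

end Transport

end Multigraph

theorem theorem6 {α : Type*} {β : Type*} (G : Graph α β) (m : ℕ) (hm : 3 ≤ m)
    (hG : Multigraph.IsCycleMaximal G m) :
    (9 / 10 : ℝ) * (3 : ℝ) ^ ((m : ℝ) / 3) < 4 * (3 : ℝ) ^ (((m : ℝ) - 4) / 3) ∧
      4 * (3 : ℝ) ^ (((m : ℝ) - 4) / 3) ≤ (Multigraph.numCycles G : ℝ) ∧
      (Multigraph.numCycles G : ℝ) ≤ 8.25 * (3 : ℝ) ^ ((m : ℝ) / 3) ∧
      Multigraph.IsFiniteLooplessWithEdges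
        (Multigraph.multipliedCycle (max 2 ((m + 1) / 3)) m) m ∧
      4 * (3 : ℝ) ^ (((m : ℝ) - 4) / 3) ≤
        (Multigraph.numCycles (Multigraph.multipliedCycle (max 2 ((m + 1) / 3)) m) : ℝ) := by
  rw [Multigraph.three_rpow_sub_four_div_three, Multigraph.three_rpow_div_three]
  have hM := Multigraph.isFiniteLooplessWithEdges_multipliedCycle
    (le_max_left 2 ((m + 1) / 3)) m
  have hlow := Multigraph.le_numCycles_multipliedCycle hm
  refine ⟨?_, hlow.trans (Nat.cast_le.2 ?_), hG.mem.numCycles_le, hM, hlow⟩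
  · have hpos := pow_pos Multigraph.cbrtThree_pos m
    have hr := Multigraph.lt_cbrtThree
    -- After cancelling r^m, the claim is r² > 81/40 = 2.025.
    have hsq : 2.07 < Multigraph.cbrtThree ^ 2 := by norm_num at hr ⊢; nlinarith
    rw [pow_add]
    norm_num at hsq ⊢
    nlinarith
  -- Maximality of G only compares graphs in its own universes, so the multiplied cycle is lifted
  -- there.
  · exact (hM.numCycles_le_copyAlong Equiv.ulift Equiv.ulift).trans
      (hG.le _ _ _ (hM.copyAlong Equiv.ulift Equiv.ulift))
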